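/- Let $\mathbb{S}$ be the ring of stable proper rational functions: rational functions of $s$ with real coefficients that have no pole in the closed right half plane $\operatorname{Re} s\ge 0$ and no pole at infinity. Let $M(\mathbb{S})$ be the set of $n\times n$ matrices with entries in $\mathbb{S}$. (A function is said to have no zero at infinity if it is not identically zero and its value at infinity is not $0$.) A hybrid network function is a proper real rational $n\times n$ matrix which is invertible and whose inverse is proper. A doubly coprime factorization of a proper real rational matrix $T$ consists of $N_r,D_r,N_l,D_l,X_l,Y_l,X_r,Y_r\in M(\mathbb{S})$ such that $\det D_r$ and $\det D_l$ have no zero at infinity, $T=N_rD_r^{-1}=D_l^{-1}N_l$, and $$\begin{bmatrix} X_l & Y_l\\ D_l & -N_l\end{bmatrix}\begin{bmatrix} N_r & Y_r\\ D_r & -X_r\end{bmatrix}=\begin{bmatrix} I&0\\0&I\end{bmatrix}.$$ A neighbourhood of $T$ is a set that, for some doubly coprime factorization of $T$ and some $\varepsilon>0$, contains every $\tilde T$ having a doubly coprime factorization whose matrices $\tilde N_r,\tilde D_r,\tilde N_l,\tilde D_l$ are entrywise within $\varepsilon$ of $N_r,D_r,N_l,D_l$ in the supremum norm over $\operatorname{Re}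 s\ge0$. A hybrid network function $T_c$ is a stabilizing hybrid compensator of $T$ if $(T^{-1}+T_c^{-1})^{-1}$ exists and belongs to $M(\mathbb{S})$, and $(\tilde T^{-1}+T_c^{-1})^{-1}$ exists and belongs to $M(\mathbb{S})$ for all $\tilde T$ in some neighbourhood of $T$. Corollary. Let $T$ be a hybrid network function with a given doubly coprime factorization. Call $Q\in M(\mathbb{S})$ admissible if $\det(X_l-QD_l)$ and $\det(X_r-D_rQ)$ have no zero at infinity. Then for every admissible $Q$ $$(X_l-QD_l)^{-1}(Y_l+QN_l)=(Y_r+N_rQ)(X_r-D_rQ)^{-1},$$ and the set of all stabilizing hybrid compensators of $T$ is equal to the set of all hybrid network functions $T_c$ of the form $T_c=(X_l-QD_l)^{-1}(Y_l+QN_l)$ with $Q$ admissible, and also to the set of all hybrid network functions $T_c$ of the form $T_c=(Y_r+N_rQ)(X_r-D_rQ)^{-1}$ with $Q$ admissible. -/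

import Mathlib

/-- A rational function with real coefficients is proper if the degree of its numerator does
not exceed the degree of its denominator, i.e. if it has no pole at infinity. -/
def IsProperFun (f : RatFunc ℝ) : Prop :=
  f.num.natDegree ≤ f.denom.natDegree

/-- The set `𝕊` of stable proper transfer functions: proper, and without poles in the closed
right half complex plane. -/
def IsStableFun (f : RatFunc ℝ) : Prop :=
  IsProperFun f ∧ ∀ z : ℂ, 0 ≤ z.re → Polynomial.aeval z f.denom ≠ 0

/-- A rational function has no zero at infinity: it is not the zero function and the degree of
its denominator does not exceed the degree of its numerator. -/
def NoZeroAtInfinity (f : RatFunc ℝ) : Prop :=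
  f ≠ 0 ∧ f.denom.natDegree ≤ f.num.natDegree

/-- Square matrices of rational functions, indexed by the ports of a network. -/
abbrev RatMatrix (ι : Type*) := Matrix ι ι (RatFunc ℝ)

/-- All entries are proper. -/
def IsProperMatrix {ι : Type*} (A : RatMatrix ι) : Prop :=
  ∀ i j, IsProperFun (A i j)

/-- Membership in `M(𝕊)`: all entries are stable proper functions. -/
def IsStableMatrix {ι : Type*} (A : RatMatrix ι) : Prop :=
  ∀ i j, IsStableFun (A i j)

/-- `A` and `B` are within `ε` of each other, entry by entry, in the supremum (`H^∞`) norm over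
the closed right half plane. It is used for matrices in `M(𝕊)` only. -/
def HInfClose {ι : Type*} (ε : ℝ) (A B : RatMatrix ι) : Prop :=
  ∀ i j, ∀ z : ℂ, 0 ≤ z.re → ‖RatFunc.eval (algebraMap ℝ ℂ) z (A i j - B i j)‖ ≤ ε

section Networks

variable {ι : Type*} [Fintype ι] [DecidableEq ι]

/-- Hybrid network functions: proper rational matrices that have a proper rational inverse. -/
structure IsNetworkFunction (T : RatMatrix ι) : Prop where
  proper : IsProperMatrix T
  isUnit_det : IsUnit T.det
  proper_inv : IsProperMatrix T⁻¹

/-- The eight matrices that make up a doubly coprime fractional representation. -/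
structure Fractions (ι : Type*) where
  (Nr Dr Nl Dl Xl Yl Xr Yr : RatMatrix ι)

/-- `F` is a doubly coprime fractional representation of `T`. -/
structure Fractions.IsDCF (F : Fractions ι) (T : RatMatrix ι) : Prop where
  stable_Nr : IsStableMatrix F.Nr
  stable_Dr : IsStableMatrix F.Dr
  stable_Nl : IsStableMatrix F.Nl
  stable_Dl : IsStableMatrix F.Dl
  stable_Xl : IsStableMatrix F.Xl
  stable_Yl : IsStableMatrix F.Yl
  stable_Xr : IsStableMatrix F.Xr
  stable_Yr : IsStableMatrix F.Yr
  det_Dr : NoZeroAtInfinity F.Dr.det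
  det_Dl : NoZeroAtInfinity F.Dl.det
  eq_right : T = F.Nr * F.Dr⁻¹
  eq_left : T = F.Dl⁻¹ * F.Nl
  bezout : Matrix.fromBlocks F.Xl F.Yl F.Dl (-F.Nl) *
    Matrix.fromBlocks F.Nr F.Yr F.Dr (-F.Xr) = 1

/-- `U` is a neighbourhood of `T`: for some doubly coprime fractional representation `F` of `T`
and some `ε > 0`, it contains every `T'` that has a doubly coprime fractional representation
whose fractions are `ε`-close to the respective fractions of `F`. -/
def IsNeighbourhood (T : RatMatrix ι) (U : Set (RatMatrix ι)) : Prop :=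
  ∃ F : Fractions ι, F.IsDCF T ∧ ∃ ε : ℝ, 0 < ε ∧
    ∀ (T' : RatMatrix ι) (F' : Fractions ι), F'.IsDCF T' →
      HInfClose ε F'.Nr F.Nr → HInfClose ε F'.Dr F.Dr →
      HInfClose ε F'.Nl F.Nl → HInfClose ε F'.Dl F.Dl → T' ∈ U

/-- The port interconnection of `T` and `Tc` has a hybrid matrix `(T⁻¹ + Tc⁻¹)⁻¹` (all three
inverses exist), and this matrix lies in `M(𝕊)`. -/
structure InterconnectionStable (T Tc : RatMatrix ι) : Prop where
  isUnit_det : IsUnit T.det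
  isUnit_det_comp : IsUnit Tc.det
  isUnit_det_sum : IsUnit (T⁻¹ + Tc⁻¹).det
  stable : IsStableMatrix (T⁻¹ + Tc⁻¹)⁻¹

/-- `Tc` is a stabilizing hybrid compensator of `T`: it is a hybrid network function, its
interconnection with `T` is stable, and so is its interconnection with every `T'` in some
neighbourhood of `T`. -/
structure IsStabilizing (T Tc : RatMatrix ι) : Prop where
  networkFunction : IsNetworkFunction Tc
  stable : InterconnectionStable T Tc
  robust : ∃ U : Set (RatMatrix ι), IsNeighbourhood T U ∧ ∀ T' ∈ U, InterconnectionStable T' Tc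

/-- The admissible parameters: `Q` in `M(𝕊)` such that `det (Xl - Q Dl)` and `det (Xr - Dr Q)`
have no zero at infinity. -/
structure Fractions.IsParameter (F : Fractions ι) (Q : RatMatrix ι) : Prop where
  stable : IsStableMatrix Q
  det_left : NoZeroAtInfinity (F.Xl - Q * F.Dl).det
  det_right : NoZeroAtInfinity (F.Xr - F.Dr * Q).det

end Networks

/-!
With `P = Xl - Q Dl`, `R = Yl + Q Nl` the Bezout identity gives `P Nr + R Dr = 1`, so that for
`Tc = P⁻¹ R` and any `T' = Nr' Dr'⁻¹`
`(T'⁻¹ + Tc⁻¹)⁻¹ = Nr' (P Nr' + R Dr')⁻¹ R`  (`inv_add_inv_eq`).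

*Sufficiency.* If `Q`, hence `P` and `R`, are stable, then `P Nr' + R Dr'` is uniformly close to `1`
on the closed right half plane whenever `T'` is close to `T`. Its determinant is then bounded below
there, and such functions are the units of `𝕊` (`IsStableFun.inv`, `exists_pos_stable_inv`).

*Necessity.* Every `Tc` with `T + Tc` invertible has the form `P⁻¹ R` for one rational matrix `Q`
(`Fractions.IsDCF.exists_param`), and it has to be shown that `Q` is stable. Stability of the
interconnection with `T` alone does not imply this, as poles may be hidden. The robustness condition
is tested against the perturbations `Nr + Yr Γ`, `Dr - Xr Γ` with a stable `Γ`
(`Fractions.dual`), for which `P Nr' + R Dr' = 1 - Q Γ`. Let `Γ` have the single nonzero entry `β`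
in position `(i, j)`. By the Sherman–Morrison formula the hybrid matrix of the interconnection
changes by the rank-one matrix
`β / (1 - β Q j i) • (Yr + Nr Q) eᵢ eⱼᵀ R`
(`Fractions.IsDCF.interconnection_dual`, `mul_single_mul_eq_smul`), and some entry of it has a
numerator that is not identically zero, since `Yr + Nr Q` and `R` are invertible. If `Q j i` had a
pole `z₀` in the closed right half plane, `Q j i` would be large at the points `z₀ + t` with small
`t > 0`, and a uniformly small `β` could be found with `1 - β Q j i` vanishing at such a point
(`exists_interpolant`). The perturbed interconnection would have a pole there. At infinity no
perturbation is needed, because `T`, `Tc` and their inverses are proper.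

A neighbourhood of `T` may refer to a factorization other than the given one, and
`Fractions.IsDCF.change_fractions` transports stable parameters between factorizations.
-/

open Polynomial Filter Topology Matrix

/-! ### Subrings of rational functions -/

theorem isProperFun_iff {f : RatFunc ℝ} : IsProperFun f ↔ f.intDegree ≤ 0 := by
  simp [IsProperFun, RatFunc.intDegree]

/-- The ring of proper rational functions. -/
noncomputable def properSubring : Subring (RatFunc ℝ) where
  carrier := {f | IsProperFun f}
  zero_mem' := isProperFun_iff.2 (by simp)
  one_mem' := isProperFun_iff.2 (by simp)
  neg_mem' := fun {f} hf => isProperFun_iff.2 (by simpa using isProperFun_iff.1 hf)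
  add_mem' := by
    intro f g hf hg
    by_cases h0 : g = 0
    · simpa [h0] using hf
    by_cases h1 : f + g = 0
    · exact isProperFun_iff.2 (by simp [h1])
    · exact isProperFun_iff.2 ((RatFunc.intDegree_add_le h0 h1).trans
        (max_le (isProperFun_iff.1 hf) (isProperFun_iff.1 hg)))
  mul_mem' := by
    intro f g hf hg
    by_cases h0 : f = 0
    · exact isProperFun_iff.2 (by simp [h0])
    by_cases h1 : g = 0
    · exact isProperFun_iff.2 (by simp [h1])
    · refine isProperFun_iff.2 ?_
      rw [RatFunc.intDegree_mul h0 h1]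
      exact add_nonpos (isProperFun_iff.1 hf) (isProperFun_iff.1 hg)

/-- The ring of rational functions without a pole at `z`. -/
noncomputable def regularSubring (z : ℂ) : Subring (RatFunc ℝ) where
  carrier := {f | aeval z f.denom ≠ 0}
  zero_mem' := by simp
  one_mem' := by simp
  neg_mem' := by
    intro f hf h
    refine hf (zero_dvd_iff.1 (h ▸ map_dvd (aeval z) ?_))
    rw [RatFunc.denom_dvd f.denom_ne_zero]
    exact ⟨-f.num, by rw [map_neg, neg_div, RatFunc.num_div_denom]⟩
  add_mem' := by
    intro f g hf hg h
    have := map_dvd (aeval z) (RatFunc.denom_add_dvd f g)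
    rw [h, zero_dvd_iff, map_mul] at this
    exact (mul_ne_zero hf hg) this
  mul_mem' := by
    intro f g hf hg h
    have := map_dvd (aeval z) (RatFunc.denom_mul_dvd f g)
    rw [h, zero_dvd_iff, map_mul] at this
    exact (mul_ne_zero hf hg) this

/-- The ring `𝕊` of stable proper rational functions. -/
noncomputable def stableSubring : Subring (RatFunc ℝ) :=
  properSubring ⊓ ⨅ z : {z : ℂ // 0 ≤ z.re}, regularSubring z

theorem mem_stableSubring {f : RatFunc ℝ} : f ∈ stableSubring ↔ IsStableFun f := by
  simp only [stableSubring, Subring.mem_inf, Subring.mem_iInf, Subtype.forall]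
  rfl

theorem stableSubring_le_properSubring : stableSubring ≤ properSubring := inf_le_left

theorem stableSubring_le_regularSubring {z : ℂ} (hz : 0 ≤ z.re) :
    stableSubring ≤ regularSubring z :=
  inf_le_right.trans (iInf_le (fun z : {z : ℂ // 0 ≤ z.re} => regularSubring z) ⟨z, hz⟩)

/-- Evaluation at `z`, as a ring homomorphism on the rational functions without a pole at `z`. -/
noncomputable def evalHom (z : ℂ) : regularSubring z →+* ℂ where
  toFun f := RatFunc.eval (algebraMap ℝ ℂ) z f
  map_zero' := by simp
  map_one' := by simp
  map_add' f g := RatFunc.eval_add _ _ f.2 g.2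
  map_mul' f g := RatFunc.eval_mul _ _ f.2 g.2

theorem eval_mul_of_mem {z : ℂ} {f g : RatFunc ℝ} (hf : f ∈ regularSubring z)
    (hg : g ∈ regularSubring z) :
    RatFunc.eval (algebraMap ℝ ℂ) z (f * g) =
      RatFunc.eval (algebraMap ℝ ℂ) z f * RatFunc.eval (algebraMap ℝ ℂ) z g :=
  RatFunc.eval_mul _ _ hf hg

section MatrixSubring

variable {ι R : Type*} [Fintype ι] [DecidableEq ι]

/-- The square matrices with entries in a subring, as a subring of the ring of all square
matrices. -/
def matrixSubring [CommRing R] (S : Subring R) : Subring (Matrix ι ι R) :=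
  S.subtype.mapMatrix.range

theorem mem_matrixSubring [CommRing R] {S : Subring R} {A : Matrix ι ι R} :
    A ∈ matrixSubring S ↔ ∀ i j, A i j ∈ S := by
  constructor
  · rintro ⟨B, rfl⟩ i j
    exact (B i j).2
  · intro h
    exact ⟨Matrix.of fun i j => ⟨A i j, h i j⟩, rfl⟩

theorem matrixSubring_mono [CommRing R] {S S' : Subring R} (h : S ≤ S') :
    (matrixSubring S : Subring (Matrix ι ι R)) ≤ matrixSubring S' := fun _ hA =>
  mem_matrixSubring.2 fun i j => h (mem_matrixSubring.1 hA i j)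

theorem det_mem_of_mem_matrixSubring [CommRing R] {S : Subring R} {A : Matrix ι ι R}
    (hA : A ∈ matrixSubring S) : A.det ∈ S := by
  obtain ⟨B, rfl⟩ := hA
  rw [← RingHom.map_det]
  exact B.det.2

theorem inv_mem_matrixSubring {K : Type*} [Field K] {S : Subring K} {A : Matrix ι ι K}
    (hA : A ∈ matrixSubring S) (hdet : A.det⁻¹ ∈ S) : A⁻¹ ∈ matrixSubring S := by
  obtain ⟨B, rfl⟩ := hA
  rw [Matrix.inv_def, Ring.inverse_eq_inv', ← RingHom.map_adjugate]
  exact mem_matrixSubring.2 fun i j => S.mul_mem hdet (B.adjugate i j).2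

end MatrixSubring

theorem isStableMatrix_iff {ι : Type*} [Fintype ι] [DecidableEq ι] {A : RatMatrix ι} :
    IsStableMatrix A ↔ A ∈ matrixSubring stableSubring := by
  simp only [IsStableMatrix, mem_matrixSubring, mem_stableSubring]

theorem isProperMatrix_iff {ι : Type*} [Fintype ι] [DecidableEq ι] {A : RatMatrix ι} :
    IsProperMatrix A ↔ A ∈ matrixSubring properSubring :=
  (mem_matrixSubring (S := properSubring)).symm

theorem IsStableMatrix.mem_stable {ι : Type*} [Fintype ι] [DecidableEq ι] {A : RatMatrix ι}
    (hA : IsStableMatrix A) : A ∈ matrixSubring stableSubring :=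
  isStableMatrix_iff.1 hA

theorem IsStableMatrix.mem_proper {ι : Type*} [Fintype ι] [DecidableEq ι] {A : RatMatrix ι}
    (hA : IsStableMatrix A) : A ∈ matrixSubring properSubring :=
  matrixSubring_mono stableSubring_le_properSubring hA.mem_stable

theorem IsStableMatrix.mem_regular {ι : Type*} [Fintype ι] [DecidableEq ι] {A : RatMatrix ι}
    (hA : IsStableMatrix A) {z : ℂ} (hz : 0 ≤ z.re) : A ∈ matrixSubring (regularSubring z) :=
  matrixSubring_mono (stableSubring_le_regularSubring hz) hA.mem_stable

theorem NoZeroAtInfinity.inv_mem {f : RatFunc ℝ} (hf : NoZeroAtInfinity f) :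
    f⁻¹ ∈ properSubring := by
  refine isProperFun_iff.2 ?_
  have := hf.2
  rw [RatFunc.intDegree_inv, RatFunc.intDegree]
  lia

theorem noZeroAtInfinity_of_mul_eq_one {f g : RatFunc ℝ} (h : f * g = 1)
    (hg : g ∈ properSubring) : NoZeroAtInfinity f := by
  have hf : f ≠ 0 := left_ne_zero_of_mul_eq_one h
  refine ⟨hf, ?_⟩
  have h1 : g.intDegree ≤ 0 := isProperFun_iff.1 hg
  rw [eq_inv_of_mul_eq_one_right h, RatFunc.intDegree_inv, RatFunc.intDegree] at h1
  lia

/-! ### Evaluation on the closed right half plane -/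

section Eval

variable {ι : Type*} [Fintype ι] [DecidableEq ι]

/-- The complex matrix of the values at `z`. -/
noncomputable def evalMatrix (z : ℂ) (A : RatMatrix ι) : Matrix ι ι ℂ :=
  A.map (RatFunc.eval (algebraMap ℝ ℂ) z)

theorem evalMatrix_eq (z : ℂ) (B : Matrix ι ι (regularSubring z)) :
    evalMatrix z ((regularSubring z).subtype.mapMatrix B) = (evalHom z).mapMatrix B := rfl

theorem evalMatrix_mul {z : ℂ} {A B : RatMatrix ι} (hA : A ∈ matrixSubring (regularSubring z))
    (hB : B ∈ matrixSubring (regularSubring z)) :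
    evalMatrix z (A * B) = evalMatrix z A * evalMatrix z B := by
  obtain ⟨A, rfl⟩ := hA
  obtain ⟨B, rfl⟩ := hB
  rw [← map_mul, evalMatrix_eq, evalMatrix_eq, evalMatrix_eq, map_mul]

theorem evalMatrix_add {z : ℂ} {A B : RatMatrix ι} (hA : A ∈ matrixSubring (regularSubring z))
    (hB : B ∈ matrixSubring (regularSubring z)) :
    evalMatrix z (A + B) = evalMatrix z A + evalMatrix z B := by
  obtain ⟨A, rfl⟩ := hA
  obtain ⟨B, rfl⟩ := hB
  rw [← map_add, evalMatrix_eq, evalMatrix_eq, evalMatrix_eq, map_add]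

theorem evalMatrix_sub {z : ℂ} {A B : RatMatrix ι} (hA : A ∈ matrixSubring (regularSubring z))
    (hB : B ∈ matrixSubring (regularSubring z)) :
    evalMatrix z (A - B) = evalMatrix z A - evalMatrix z B := by
  obtain ⟨A, rfl⟩ := hA
  obtain ⟨B, rfl⟩ := hB
  rw [← map_sub, evalMatrix_eq, evalMatrix_eq, evalMatrix_eq, map_sub]

theorem evalMatrix_one (z : ℂ) : evalMatrix z (1 : RatMatrix ι) = 1 := by
  rw [← map_one (regularSubring z).subtype.mapMatrix, evalMatrix_eq, map_one]

theorem det_evalMatrix {z : ℂ} {A : RatMatrix ι} (hA : A ∈ matrixSubring (regularSubring z)) :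
    (evalMatrix z A).det = RatFunc.eval (algebraMap ℝ ℂ) z A.det := by
  obtain ⟨A, rfl⟩ := hA
  rw [evalMatrix_eq, ← RingHom.map_det, ← RingHom.map_det]
  rfl

end Eval

theorem aeval_reflect_inv_mul_pow {p : ℝ[X]} {N : ℕ} (hp : p.natDegree ≤ N) {z : ℂ}
    (hz : z ≠ 0) : aeval z⁻¹ (reflect N p) * z ^ N = aeval z p := by
  let := invertibleOfNonzero hz
  simpa [aeval_def] using eval₂_reflect_mul_pow (algebraMap ℝ ℂ) z N p hp

/-- A proper rational function has a limit at infinity. As denominators are normalized to be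
monic, the limit is the coefficient of the numerator in the degree of the denominator. -/
theorem tendsto_eval_cocompact {f : RatFunc ℝ} (hf : IsProperFun f) :
    Tendsto (fun z : ℂ => RatFunc.eval (algebraMap ℝ ℂ) z f) (cocompact ℂ)
      (𝓝 (f.num.coeff f.denom.natDegree : ℂ)) := by
  set d := f.denom.natDegree with hd
  have key : ∀ p : ℝ[X], Tendsto (fun z : ℂ => aeval z⁻¹ (reflect d p)) (cocompact ℂ)
      (𝓝 (p.coeff d : ℂ)) := by
    intro p
    have h0 : aeval (0 : ℂ) (reflect d p) = (p.coeff d : ℂ) := by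
      rw [← coeff_zero_eq_aeval_zero', coeff_reflect, revAt_zero]
      rfl
    rw [← h0]
    exact ((Polynomial.continuous_aeval (reflect d p)).tendsto 0).comp
      (Metric.cobounded_eq_cocompact (α := ℂ) ▸ tendsto_inv₀_cobounded)
  have hden := key f.denom
  have hlim := (key f.num).div hden
    (by rw [hd, (RatFunc.monic_denom f).coeff_natDegree]; simp)
  have hone : (f.denom.coeff d : ℂ) = 1 := by
    rw [hd, (RatFunc.monic_denom f).coeff_natDegree]; simp
  rw [hone, div_one] at hlim
  have hne : ∀ᶠ z : ℂ in cocompact ℂ, z ≠ 0 :=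
    (isCompact_singleton (x := (0 : ℂ))).compl_mem_cocompact
  refine hlim.congr' ?_
  filter_upwards [hne] with z hz
  rw [RatFunc.eval, ← aeval_def, ← aeval_def, ← aeval_reflect_inv_mul_pow hf hz,
    ← aeval_reflect_inv_mul_pow le_rfl hz]
  exact (mul_div_mul_right _ _ (pow_ne_zero _ hz)).symm

theorem continuousAt_eval {f : RatFunc ℝ} {z : ℂ} (hz : f ∈ regularSubring z) :
    ContinuousAt (fun z : ℂ => RatFunc.eval (algebraMap ℝ ℂ) z f) z :=
  (Polynomial.continuous_aeval f.num).continuousAt.div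
    (Polynomial.continuous_aeval f.denom).continuousAt hz

theorem isClosed_rightHalfPlane : IsClosed {z : ℂ | 0 ≤ z.re} :=
  isClosed_le continuous_const Complex.continuous_re

theorem IsStableFun.exists_bound {f : RatFunc ℝ} (hf : IsStableFun f) :
    ∃ C : ℝ, ∀ z : ℂ, 0 ≤ z.re → ‖RatFunc.eval (algebraMap ℝ ℂ) z f‖ ≤ C := by
  obtain ⟨C₁, hC₁⟩ := (tendsto_eval_cocompact hf.1).norm.isBoundedUnder_le
  obtain ⟨K, hK, hKC⟩ := mem_cocompact.1 hC₁
  obtain ⟨C₂, hC₂⟩ := (hK.inter_right isClosed_rightHalfPlane).exists_bound_of_continuousOn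
    (f := fun z : ℂ => RatFunc.eval (algebraMap ℝ ℂ) z f)
    (fun z hz => (continuousAt_eval (hf.2 z hz.2)).continuousWithinAt)
  refine ⟨max C₁ C₂, fun z hz => ?_⟩
  by_cases h : z ∈ K
  · exact (hC₂ z ⟨h, hz⟩).trans (le_max_right _ _)
  · exact (show _ ≤ C₁ from hKC h).trans (le_max_left _ _)

theorem IsStableMatrix.exists_bound {ι : Type*} [Finite ι] {A : RatMatrix ι}
    (hA : IsStableMatrix A) : ∃ C : ℝ, ∀ i j, ∀ z : ℂ, 0 ≤ z.re →
      ‖RatFunc.eval (algebraMap ℝ ℂ) z (A i j)‖ ≤ C := by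
  choose C hC using fun p : ι × ι => (hA p.1 p.2).exists_bound
  obtain ⟨M, hM⟩ := (Set.finite_range C).bddAbove
  exact ⟨M, fun i j z hz => (hC (i, j) z hz).trans (hM ⟨(i, j), rfl⟩)⟩

/-- The units of `𝕊` are the functions whose absolute value is bounded below. -/
theorem IsStableFun.inv {f : RatFunc ℝ} (hf : IsStableFun f) {δ : ℝ} (hδ : 0 < δ)
    (hb : ∀ z : ℂ, 0 ≤ z.re → δ ≤ ‖RatFunc.eval (algebraMap ℝ ℂ) z f‖) : IsStableFun f⁻¹ := by
  have hnum : ∀ z : ℂ, 0 ≤ z.re → aeval z f.num ≠ 0 := by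
    intro z hz h0
    have := hb z hz
    rw [RatFunc.eval, ← aeval_def, h0, zero_div, norm_zero] at this
    exact hδ.not_ge this
  have hf0 : f ≠ 0 := by
    rintro rfl
    exact hnum 0 le_rfl (by simp)
  constructor
  · have hcast : Tendsto (fun n : ℕ => (n : ℂ)) atTop (cocompact ℂ) := by
      rw [← Metric.cobounded_eq_cocompact, ← tendsto_norm_atTop_iff_cobounded]
      simpa using tendsto_natCast_atTop_atTop (R := ℝ)
    have hle := ge_of_tendsto' ((tendsto_eval_cocompact hf.1).comp hcast).norm
      (fun n => hb (n : ℂ) (by simp))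
    have hcoeff : f.num.coeff f.denom.natDegree ≠ 0 := by
      intro h0
      rw [h0] at hle
      simp only [Complex.ofReal_zero, norm_zero] at hle
      exact hδ.not_ge hle
    have := le_natDegree_of_ne_zero hcoeff
    rw [isProperFun_iff, RatFunc.intDegree_inv, RatFunc.intDegree]
    lia
  · intro z hz h0
    refine hnum z hz (zero_dvd_iff.1 ?_)
    rw [← h0]
    exact map_dvd _ (RatFunc.denom_inv_dvd hf0)

/-! ### Algebra of doubly coprime factorizations -/

section Algebra

variable {ι : Type*} [Fintype ι] [DecidableEq ι] {T Tc : RatMatrix ι} {F : Fractions ι}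

namespace Fractions.IsDCF

theorem isUnit_det_Dr (hF : F.IsDCF T) : IsUnit F.Dr.det := hF.det_Dr.1.isUnit

theorem isUnit_det_Dl (hF : F.IsDCF T) : IsUnit F.Dl.det := hF.det_Dl.1.isUnit

theorem left_bezout (hF : F.IsDCF T) :
    F.Xl * F.Nr + F.Yl * F.Dr = 1 ∧ F.Xl * F.Yr = F.Yl * F.Xr ∧
      F.Dl * F.Nr = F.Nl * F.Dr ∧ F.Dl * F.Yr + F.Nl * F.Xr = 1 := by
  have h := hF.bezout
  rw [fromBlocks_multiply, ← fromBlocks_one, fromBlocks_inj] at h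
  obtain ⟨h1, h2, h3, h4⟩ := h
  refine ⟨h1, ?_, ?_, by simpa using h4⟩
  · rwa [mul_neg, ← sub_eq_add_neg, sub_eq_zero] at h2
  · rwa [neg_mul, ← sub_eq_add_neg, sub_eq_zero] at h3

theorem right_bezout (hF : F.IsDCF T) :
    F.Nr * F.Xl + F.Yr * F.Dl = 1 ∧ F.Nr * F.Yl = F.Yr * F.Nl ∧
      F.Dr * F.Xl = F.Xr * F.Dl ∧ F.Dr * F.Yl + F.Xr * F.Nl = 1 := by
  have h := mul_eq_one_comm.1 hF.bezout
  rw [fromBlocks_multiply, ← fromBlocks_one, fromBlocks_inj] at h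
  obtain ⟨h1, h2, h3, h4⟩ := h
  refine ⟨h1, ?_, ?_, by simpa using h4⟩
  · rwa [mul_neg, ← sub_eq_add_neg, sub_eq_zero] at h2
  · rwa [neg_mul, ← sub_eq_add_neg, sub_eq_zero] at h3

theorem T_mul_Dr (hF : F.IsDCF T) : T * F.Dr = F.Nr := by
  rw [hF.eq_right, nonsing_inv_mul_cancel_right _ _ hF.isUnit_det_Dr]

theorem Dl_mul_T (hF : F.IsDCF T) : F.Dl * T = F.Nl := by
  rw [hF.eq_left, mul_nonsing_inv_cancel_left _ _ hF.isUnit_det_Dl]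

/-- For every parameter the two denominators and numerators of the compensator solve the Bezout
equation of the right factorization. -/
theorem param_bezout (hF : F.IsDCF T) (Q : RatMatrix ι) :
    (F.Xl - Q * F.Dl) * F.Nr + (F.Yl + Q * F.Nl) * F.Dr = 1 := by
  obtain ⟨h1, -, h3, -⟩ := hF.left_bezout
  linear_combination (norm := noncomm_ring) h1 - Q * h3

theorem param_bezout' (hF : F.IsDCF T) (Q : RatMatrix ι) :
    F.Dl * (F.Yr + F.Nr * Q) + F.Nl * (F.Xr - F.Dr * Q) = 1 := by
  obtain ⟨-, -, h3, h4⟩ := hF.left_bezout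
  linear_combination (norm := noncomm_ring) h4 + h3 * Q

theorem param_comm (hF : F.IsDCF T) (Q : RatMatrix ι) :
    (F.Xl - Q * F.Dl) * (F.Yr + F.Nr * Q) = (F.Yl + Q * F.Nl) * (F.Xr - F.Dr * Q) := by
  obtain ⟨h1, h2, h3, h4⟩ := hF.left_bezout
  linear_combination (norm := noncomm_ring) h2 - Q * h4 + h1 * Q - Q * h3 * Q

/-- The parameter is recovered from the numerator and the denominator of the compensator. -/
theorem param_recover (hF : F.IsDCF T) (Q : RatMatrix ι) :
    (F.Yl + Q * F.Nl) * F.Xr - (F.Xl - Q * F.Dl) * F.Yr = Q := by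
  obtain ⟨-, h2, -, h4⟩ := hF.left_bezout
  linear_combination (norm := noncomm_ring) - h2 + Q * h4

/-- Every rational compensator for which `T + Tc` is invertible comes from a rational
parameter, which need not be stable. -/
theorem exists_param (hF : F.IsDCF T) (hsum : IsUnit (T + Tc).det) :
    ∃ Q : RatMatrix ι, Q = (F.Xl - F.Dr⁻¹ * (T + Tc)⁻¹) * F.Dl⁻¹ ∧
      F.Yl + Q * F.Nl = (F.Xl - Q * F.Dl) * Tc := by
  refine ⟨_, rfl, ?_⟩
  have hP : F.Xl - (F.Xl - F.Dr⁻¹ * (T + Tc)⁻¹) * F.Dl⁻¹ * F.Dl = F.Dr⁻¹ * (T + Tc)⁻¹ := by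
    rw [nonsing_inv_mul_cancel_right _ _ hF.isUnit_det_Dl, sub_sub_cancel]
  rw [hP, ← hF.Dl_mul_T, ← mul_assoc, nonsing_inv_mul_cancel_right _ _ hF.isUnit_det_Dl]
  have h1 : F.Xl * T + F.Yl = F.Dr⁻¹ := by
    have h := congrArg (· * F.Dr⁻¹) hF.left_bezout.1
    simp only [add_mul, one_mul, mul_assoc, mul_nonsing_inv _ hF.isUnit_det_Dr, mul_one] at h
    rw [← h, hF.eq_right]
  have h2 : F.Dr⁻¹ * ((T + Tc)⁻¹ * (T + Tc)) = F.Dr⁻¹ := by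
    rw [nonsing_inv_mul _ hsum, mul_one]
  linear_combination (norm := noncomm_ring) h1 - h2

section

variable {Q : RatMatrix ι}

theorem left_denom_mul (hF : F.IsDCF T) (h : F.Yl + Q * F.Nl = (F.Xl - Q * F.Dl) * Tc) :
    (F.Xl - Q * F.Dl) * ((T + Tc) * F.Dr) = 1 := by
  have h1 := hF.param_bezout Q
  rw [h, ← hF.T_mul_Dr] at h1
  linear_combination (norm := noncomm_ring) h1

theorem right_num_eq (hF : F.IsDCF T) (h : F.Yl + Q * F.Nl = (F.Xl - Q * F.Dl) * Tc) :
    F.Yr + F.Nr * Q = Tc * (F.Xr - F.Dr * Q) := by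
  have hP : IsUnit (F.Xl - Q * F.Dl).det := isUnit_det_of_right_inverse (hF.left_denom_mul h)
  rw [← nonsing_inv_mul_cancel_left _ (F.Yr + F.Nr * Q) hP, hF.param_comm, h,
    mul_assoc _ Tc, nonsing_inv_mul_cancel_left _ _ hP]

theorem right_denom_mul (hF : F.IsDCF T) (h : F.Yl + Q * F.Nl = (F.Xl - Q * F.Dl) * Tc) :
    (F.Xr - F.Dr * Q) * (F.Dl * (T + Tc)) = 1 := by
  have h3 := hF.param_bezout' Q
  rw [hF.right_num_eq h, ← hF.Dl_mul_T] at h3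
  refine mul_eq_one_comm.1 ?_
  linear_combination (norm := noncomm_ring) h3

end

/-- Passing to another factorization `F` of the same matrix multiplies the denominator and the
numerator of the compensator by `Xl Nr₀ + Yl Dr₀`, which is invertible with inverse
`P₀ Nr + R₀ Dr`. The new parameter is a polynomial expression in the old one and the data of both
factorizations. -/
theorem change_fractions {F₀ : Fractions ι} (hF : F.IsDCF T) (hF₀ : F₀.IsDCF T)
    {P₀ R₀ : RatMatrix ι} (h₀ : P₀ * F₀.Nr + R₀ * F₀.Dr = 1) :
    let A := F.Xl * F₀.Nr + F.Yl * F₀.Dr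
    let Q := A * (R₀ * F.Xr - P₀ * F.Yr)
    A * (P₀ * F.Nr + R₀ * F.Dr) = 1 ∧
      F.Xl - Q * F.Dl = A * P₀ ∧ F.Yl + Q * F.Nl = A * R₀ := by
  intro A Q
  have hDr : F.Dr * F.Dr⁻¹ * F₀.Dr = F₀.Dr := by
    rw [mul_nonsing_inv _ hF.isUnit_det_Dr, one_mul]
  have hA : (P₀ * F.Nr + R₀ * F.Dr) * A = 1 := by
    have h1 : A = F.Dr⁻¹ * F₀.Dr := by
      have h2 : F.Nr * F.Dr⁻¹ * F₀.Dr = F₀.Nr := by rw [← hF.eq_right, hF₀.T_mul_Dr]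
      have h3 := congrArg (· * (F.Dr⁻¹ * F₀.Dr)) hF.left_bezout.1
      simp only [one_mul] at h3
      simp only [A]
      linear_combination (norm := noncomm_ring) h3 - F.Xl * h2 - F.Yl * hDr
    have h2 : F.Nr * F.Dr⁻¹ * F₀.Dr = F₀.Nr := by rw [← hF.eq_right, hF₀.T_mul_Dr]
    rw [h1]
    linear_combination (norm := noncomm_ring) h₀ + P₀ * h2 + R₀ * hDr
  have hA' := mul_eq_one_comm.1 hA
  obtain ⟨h1, h2, h3, h4⟩ := hF.right_bezout
  refine ⟨hA', ?_, ?_⟩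
  · simp only [Q]
    linear_combination (norm := noncomm_ring) A * P₀ * h1 - hA' * F.Xl + A * R₀ * h3
  · simp only [Q]
    linear_combination (norm := noncomm_ring) A * R₀ * h4 + A * P₀ * h2 - hA' * F.Yl

end Fractions.IsDCF

/-- For compensator fractions `Tc = P⁻¹ R`, the inverse of the hybrid matrix of the
interconnection with `T = N D⁻¹` is expressed by `P N + R D`. -/
theorem inv_add_inv_eq {N D P R : RatMatrix ι} (hT : T = N * D⁻¹) (hTc : R = P * Tc)
    (hN : IsUnit N.det) (hD : IsUnit D.det) (hR : IsUnit R.det) (hP : IsUnit P.det) :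
    T⁻¹ + Tc⁻¹ = R⁻¹ * (P * N + R * D) * N⁻¹ := by
  have h1 : Tc = P⁻¹ * R := by rw [hTc, nonsing_inv_mul_cancel_left _ _ hP]
  rw [hT, h1, Matrix.mul_inv_rev, Matrix.mul_inv_rev, nonsing_inv_nonsing_inv _ hD,
    nonsing_inv_nonsing_inv _ hP, mul_add, add_mul, ← mul_assoc, ← mul_assoc,
    mul_nonsing_inv_cancel_right _ _ hN, nonsing_inv_mul _ hR, one_mul, add_comm]

theorem add_eq_mul_inv_add_inv_mul (hT : IsUnit T.det) (hTc : IsUnit Tc.det) :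
    T + Tc = T * (T⁻¹ + Tc⁻¹) * Tc := by
  rw [mul_add, add_mul, mul_nonsing_inv _ hT, one_mul, nonsing_inv_mul_cancel_right _ _ hTc,
    add_comm]

theorem isUnit_det_add (hT : IsUnit T.det) (hTc : IsUnit Tc.det)
    (h : IsUnit (T⁻¹ + Tc⁻¹).det) : IsUnit (T + Tc).det := by
  rw [add_eq_mul_inv_add_inv_mul hT hTc, det_mul, det_mul]
  exact (hT.mul h).mul hTc

/-! ### Rank-one perturbations -/

theorem det_one_sub_single_mul {K : Type*} [Field K] (i j : ι) (β : K) (M : Matrix ι ι K) :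
    (1 - single i j β * M).det = 1 - β * M j i := by
  have h : single i j β = 
      replicateCol Unit (Pi.single i β) * replicateRow Unit (Pi.single j (1 : K)) := by
    ext a b
    simp only [single_apply, Matrix.mul_apply, replicateCol_apply, replicateRow_apply,
      Pi.single_apply, Finset.univ_unique, Finset.sum_singleton, mul_ite, mul_one, mul_zero]
    grind
  rw [h, Matrix.mul_assoc, det_one_sub_mul_comm]
  simp [Matrix.mul_apply, Pi.single_apply, mul_comm]

theorem single_mul_mul_single' {K : Type*} [Field K] (i j : ι) (β : K) (Q : Matrix ι ι K) :
    single i j β * Q * single i j β = (β * Q j i) • single i j β := by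
  ext a b
  simp only [single_mul_mul_single, Matrix.smul_apply, single_apply, smul_eq_mul]
  split_ifs <;> ring

/-- The Sherman–Morrison formula, cleared of denominators. -/
theorem mul_single_mul_eq_smul {K : Type*} [Field K] {i j : ι} {β : K} {Q S R E : Matrix ι ι K}
    (hR : IsUnit R.det) (h : S * single i j β = E * R⁻¹ * (1 - Q * single i j β)) :
    S * single i j β * R = (1 - β * Q j i) • E := by
  set Γ := single i j β with hΓ
  have hs : Γ * Q * Γ = (β * Q j i) • Γ := single_mul_mul_single' i j β Q
  set c := β * Q j i with hc
  have h1 : S * Γ = (1 - c) • (E * R⁻¹) := by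
    have h2 : S * Γ * ((1 - c) • (1 : Matrix ι ι K) + Q * Γ) = S * Γ := by
      have : S * Γ * (Q * Γ) = c • (S * Γ) := by
        rw [show S * Γ * (Q * Γ) = S * (Γ * Q * Γ) by noncomm_ring, hs, mul_smul_comm]
      rw [mul_add, this, mul_smul_comm, mul_one, ← add_smul, sub_add_cancel, one_smul]
    have h3 : (1 - Q * Γ) * ((1 - c) • (1 : Matrix ι ι K) + Q * Γ) = (1 - c) • 1 := by
      have : Q * Γ * (Q * Γ) = c • (Q * Γ) := by
        rw [show Q * Γ * (Q * Γ) = Q * (Γ * Q * Γ) by noncomm_ring, hs, mul_smul_comm]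
      rw [sub_mul, one_mul, mul_add, this, mul_smul_comm, mul_one, ← add_smul, sub_add_cancel,
        one_smul, add_sub_cancel_right]
    rw [← h2, h, mul_assoc (E * R⁻¹), h3, mul_smul_comm, mul_one]
  rw [h1, smul_mul_assoc, nonsing_inv_mul_cancel_right _ _ hR]

end Algebra

/-! ### Interpolation by small stable functions -/

/-- The function `(a s + b) / (s + 1)²`. -/
noncomputable def interpolant (a b : ℝ) : RatFunc ℝ :=
  algebraMap ℝ[X] (RatFunc ℝ) (C a * X + C b) / algebraMap ℝ[X] (RatFunc ℝ) ((X + C 1) ^ 2)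

theorem add_one_ne_zero_of_re_nonneg {z : ℂ} (hz : 0 ≤ z.re) : z + 1 ≠ 0 := by
  intro h
  have := congrArg Complex.re h
  simp at this
  linarith

theorem interpolant_mem_regularSubring (a b : ℝ) {z : ℂ} (hz : 0 ≤ z.re) :
    interpolant a b ∈ regularSubring z := by
  intro h0
  have := map_dvd (aeval z) (RatFunc.denom_div_dvd (C a * X + C b) ((X + C 1 : ℝ[X]) ^ 2))
  rw [← interpolant, h0, zero_dvd_iff] at this
  exact add_one_ne_zero_of_re_nonneg hz (by simpa using this)

theorem eval_interpolant (a b : ℝ) {z : ℂ} (hz : 0 ≤ z.re) :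
    RatFunc.eval (algebraMap ℝ ℂ) z (interpolant a b) = (a * z + b) / (z + 1) ^ 2 := by
  have hne : algebraMap ℝ[X] (RatFunc ℝ) ((X + C 1) ^ 2) ≠ 0 :=
    RatFunc.algebraMap_ne_zero (pow_ne_zero _ (X_add_C_ne_zero 1))
  have h : interpolant a b * algebraMap ℝ[X] (RatFunc ℝ) ((X + C 1) ^ 2) =
      algebraMap ℝ[X] (RatFunc ℝ) (C a * X + C b) := div_mul_cancel₀ _ hne
  have h2 := congrArg (RatFunc.eval (algebraMap ℝ ℂ) z) h
  rw [eval_mul_of_mem (interpolant_mem_regularSubring a b hz)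
    (by change aeval z _ ≠ 0; rw [RatFunc.denom_algebraMap]; simp)] at h2
  simp only [RatFunc.eval_algebraMap, Algebra.algebraMap_self, RingHom.id_apply, eval₂_pow,
    eval₂_add, eval₂_X, eval₂_C, eval₂_mul, Complex.coe_algebraMap, Complex.ofReal_one] at h2
  rw [eq_div_iff (pow_ne_zero _ (add_one_ne_zero_of_re_nonneg hz)), h2]

theorem intDegree_interpolant_neg {a b : ℝ} (h : interpolant a b ≠ 0) :
    (interpolant a b).intDegree < 0 := by
  have hne : algebraMap ℝ[X] (RatFunc ℝ) ((X + C 1) ^ 2) ≠ 0 :=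
    RatFunc.algebraMap_ne_zero (pow_ne_zero _ (X_add_C_ne_zero 1))
  have hnum : algebraMap ℝ[X] (RatFunc ℝ) (C a * X + C b) ≠ 0 := fun h0 =>
    h (by rw [interpolant, h0, zero_div])
  rw [interpolant, RatFunc.intDegree_div hnum hne, RatFunc.intDegree_polynomial,
    RatFunc.intDegree_polynomial, natDegree_pow, natDegree_X_add_C]
  have := natDegree_linear_le (a := a) (b := b)
  lia

theorem isStableFun_interpolant (a b : ℝ) : IsStableFun (interpolant a b) := by
  refine ⟨?_, fun z hz => interpolant_mem_regularSubring a b hz⟩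
  by_cases h : interpolant a b = 0
  · rw [h]; exact properSubring.zero_mem
  · exact isProperFun_iff.2 (intDegree_interpolant_neg h).le

theorem norm_eval_interpolant_le (a b : ℝ) {z : ℂ} (hz : 0 ≤ z.re) :
    ‖RatFunc.eval (algebraMap ℝ ℂ) z (interpolant a b)‖ ≤ |a| + |b| := by
  have h1 : 1 ≤ ‖z + 1‖ := by
    have := Complex.re_le_norm (z + 1)
    simp at this
    linarith
  have h2 : ‖z‖ ≤ ‖z + 1‖ := by
    rw [Complex.norm_def, Complex.norm_def]
    refine Real.sqrt_le_sqrt ?_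
    simp only [Complex.normSq_apply, Complex.add_re, Complex.one_re, Complex.add_im,
      Complex.one_im]
    nlinarith
  rw [eval_interpolant a b hz, norm_div, norm_pow, div_le_iff₀ (by positivity)]
  calc ‖(a : ℂ) * z + b‖ ≤ |a| * ‖z‖ + |b| := by
        refine (norm_add_le _ _).trans ?_
        simp
    _ ≤ (|a| + |b|) * ‖z + 1‖ ^ 2 := by
        have h3 : ‖z‖ ≤ ‖z + 1‖ ^ 2 := by nlinarith
        have h4 : 1 ≤ ‖z + 1‖ ^ 2 := by nlinarith
        nlinarith [abs_nonneg a, abs_nonneg b]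

theorem eventually_aeval_ne_zero {p : ℝ[X]} (hp : p ≠ 0) (z : ℂ) :
    ∀ᶠ t : ℝ in 𝓝[>] 0, aeval (z + t) p ≠ 0 := by
  have hfin : {t : ℝ | aeval (z + t) p = 0}.Finite := by
    refine ((p.rootSet_finite ℂ).preimage (f := fun t : ℝ => z + t) ?_).subset ?_
    · intro s _ t _ h
      simpa using h
    · intro t ht
      exact (mem_rootSet_of_ne hp).2 ht
  have h1 : ∀ᶠ t : ℝ in cofinite, aeval (z + t) p ≠ 0 := by
    simpa [eventually_cofinite] using hfin
  exact (h1.filter_mono (nhdsNE_le_cofinite 0)).filter_mono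
    (nhdsWithin_mono _ fun t ht => ne_of_gt ht)

/-- If `h` has a pole at `z₀`, a stable, strictly proper and uniformly small function `β` can be
found for which `1 - β h` vanishes at some point `z` close to `z₀` where `g` does not vanish.
The point is taken to be `z₀ + t` with a small real `t`, so that it is real if `z₀` is, and the
two real coefficients of `β` suffice to prescribe its value at `z`. -/
theorem exists_interpolant {h g : RatFunc ℝ} {z₀ : ℂ} (hz₀ : 0 ≤ z₀.re)
    (hh : h ∉ regularSubring z₀) (hg : g ≠ 0) {ε : ℝ} (hε : 0 < ε) :
    ∃ (a b : ℝ) (z : ℂ), 0 ≤ z.re ∧ h ∈ regularSubring z ∧ g ∈ regularSubring z ∧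
      RatFunc.eval (algebraMap ℝ ℂ) z g ≠ 0 ∧
      RatFunc.eval (algebraMap ℝ ℂ) z (interpolant a b) *
        RatFunc.eval (algebraMap ℝ ℂ) z h = 1 ∧ |a| + |b| ≤ ε := by
  have hden : aeval z₀ h.denom = 0 := not_not.1 hh
  have hnum : aeval z₀ h.num ≠ 0 := by
    intro h0
    obtain ⟨u, v, huv⟩ := h.isCoprime_num_denom
    have := congrArg (aeval z₀) huv
    rw [map_add, map_mul, map_mul, h0, hden] at this
    simp at this
  have hh0 : h ≠ 0 := by
    rintro rfl
    exact hnum (by simp)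
  -- `w z` is the value that `a s + b` has to take at `z`.
  set w : ℂ → ℂ := fun z => aeval z h.denom / aeval z h.num * (z + 1) ^ 2 with hw
  have hwz₀ : w z₀ = 0 := by simp [hw, hden]
  have hwcont : ContinuousAt w z₀ :=
    ((Polynomial.continuous_aeval h.denom).continuousAt.div
      (Polynomial.continuous_aeval h.num).continuousAt hnum).mul (by fun_prop)
  have hpath : Tendsto (fun t : ℝ => z₀ + t) (𝓝[>] 0) (𝓝 z₀) := by
    have : ContinuousAt (fun t : ℝ => z₀ + (t : ℂ)) 0 := by fun_prop
    have h1 : Tendsto (fun t : ℝ => z₀ + (t : ℂ)) (𝓝 0) (𝓝 z₀) := by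
      simpa [ContinuousAt] using this
    exact h1.mono_left nhdsWithin_le_nhds
  have hwt : Tendsto (fun t : ℝ => w (z₀ + t)) (𝓝[>] 0) (𝓝 0) := by
    rw [← hwz₀]
    exact hwcont.tendsto.comp hpath
  -- Division by zero makes `a` vanish at real points, as it should.
  set a : ℝ → ℝ := fun t => (w (z₀ + t)).im / z₀.im with ha
  set b : ℝ → ℝ := fun t => (w (z₀ + t)).re - a t * (z₀ + t).re with hb
  have hat : Tendsto a (𝓝[>] 0) (𝓝 0) := by
    simpa using ((Complex.continuous_im.tendsto 0).comp hwt).div_const z₀.im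
  have hbt : Tendsto b (𝓝[>] 0) (𝓝 0) := by
    simpa [hb] using ((Complex.continuous_re.tendsto 0).comp hwt).sub
      (hat.mul ((Complex.continuous_re.tendsto z₀).comp hpath))
  have hsmall : ∀ᶠ t in 𝓝[>] (0 : ℝ), |a t| + |b t| < ε := by
    have : Tendsto (fun t => |a t| + |b t|) (𝓝[>] 0) (𝓝 0) := by
      simpa using hat.abs.add hbt.abs
    exact this.eventually (gt_mem_nhds hε)
  obtain ⟨t, ht, h2, h3, h4, h6, h5⟩ := (hsmall.and
    ((eventually_aeval_ne_zero (RatFunc.num_ne_zero hh0) z₀).and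
    ((eventually_aeval_ne_zero h.denom_ne_zero z₀).and
    ((eventually_aeval_ne_zero (RatFunc.num_ne_zero hg) z₀).and
    ((eventually_aeval_ne_zero g.denom_ne_zero z₀).and
      self_mem_nhdsWithin))))).exists
  have h5 : 0 < t := h5
  have hre : 0 ≤ (z₀ + t).re := by
    simp only [Complex.add_re, Complex.ofReal_re]
    linarith
  refine ⟨a t, b t, z₀ + t, hre, h3, h6, ?_, ?_, ht.le⟩
  · exact div_ne_zero h4 h6
  · have him : (z₀ + t).im = z₀.im := by simp
    have hlin : (a t : ℂ) * (z₀ + t) + b t = w (z₀ + t) := by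
      apply Complex.ext
      · simp only [hb, Complex.add_re, Complex.mul_re, Complex.ofReal_re, Complex.ofReal_im]
        ring
      · have : a t * (z₀ + t).im = (w (z₀ + t)).im := by
          by_cases h0 : z₀.im = 0
          · rw [him, h0, mul_zero]
            obtain ⟨x, hx⟩ : ∃ x : ℝ, z₀ + t = x := ⟨(z₀ + t).re, Complex.ext (by simp)
              (by rw [him, h0, Complex.ofReal_im])⟩
            have hreal : ∀ p : ℝ[X], aeval (x : ℂ) p = ((p.eval x : ℝ) : ℂ) := fun p =>
              aeval_algebraMap_apply_eq_algebraMap_eval x p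
            simp only [hw, hx, hreal]
            norm_cast
          · rw [him]
            exact div_mul_cancel₀ _ h0
        simp only [Complex.add_im, Complex.mul_im, Complex.ofReal_re, Complex.ofReal_im] at this ⊢
        linarith
    have hne := add_one_ne_zero_of_re_nonneg hre
    rw [eval_interpolant _ _ hre, hlin, RatFunc.eval, ← aeval_def, ← aeval_def]
    simp only [hw]
    field_simp

/-! ### Perturbing the plant along the dual parametrization -/

theorem noZeroAtInfinity_one_sub_mul {β m : RatFunc ℝ} (hβ : β.intDegree < 0)
    (hm : m ∈ properSubring) : NoZeroAtInfinity (1 - β * m) := by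
  by_cases h0 : β * m = 0
  · rw [h0, sub_zero]
    exact ⟨one_ne_zero, by simp⟩
  have hm0 := right_ne_zero_of_mul h0
  have hlt : (β * m).intDegree < 0 := by
    rw [RatFunc.intDegree_mul (left_ne_zero_of_mul h0) hm0]
    have := isProperFun_iff.1 hm
    lia
  have hne : 1 - β * m ≠ 0 := by
    intro h
    rw [← sub_eq_zero.1 h] at hlt
    simp at hlt
  refine ⟨hne, ?_⟩
  by_contra! hlt'
  have h1 : (1 - β * m + β * m).intDegree = 0 := by simp
  have h2 := RatFunc.intDegree_add_le (x := 1 - β * m) h0 (by simp)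
  have h3 : (1 - β * m).intDegree < 0 := by
    rw [RatFunc.intDegree]
    lia
  rw [h1] at h2
  have := max_lt h3 hlt
  lia

theorem NoZeroAtInfinity.mul {f g : RatFunc ℝ} (hf : NoZeroAtInfinity f)
    (hg : NoZeroAtInfinity g) : NoZeroAtInfinity (f * g) := by
  refine noZeroAtInfinity_of_mul_eq_one (g := f⁻¹ * g⁻¹) ?_
    (properSubring.mul_mem hf.inv_mem hg.inv_mem)
  have := hf.1
  have := hg.1
  field_simp

section

variable {ι : Type*} [Fintype ι] [DecidableEq ι] {T Tc : RatMatrix ι} {F : Fractions ι}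

/-- The dual of the parametrization of the compensators: a stable `Γ` moves the fractions of `T`
and keeps the four matrices that solve the Bezout equations. -/
noncomputable def Fractions.dual (F : Fractions ι) (Γ : RatMatrix ι) : Fractions ι where
  Nr := F.Nr + F.Yr * Γ
  Dr := F.Dr - F.Xr * Γ
  Nl := F.Nl + Γ * F.Yl
  Dl := F.Dl - Γ * F.Xl
  Xl := F.Xl
  Yl := F.Yl
  Xr := F.Xr
  Yr := F.Yr

theorem Fractions.IsDCF.dual (hF : F.IsDCF T) {Γ : RatMatrix ι} (hΓ : IsStableMatrix Γ)
    (hr : NoZeroAtInfinity (F.Dr - F.Xr * Γ).det) (hl : NoZeroAtInfinity (F.Dl - Γ * F.Xl).det) :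
    (F.dual Γ).IsDCF ((F.dual Γ).Nr * (F.dual Γ).Dr⁻¹) := by
  obtain ⟨h1, h2, h3, h4⟩ := hF.left_bezout
  have e3 : (F.Dl - Γ * F.Xl) * (F.Nr + F.Yr * Γ) = (F.Nl + Γ * F.Yl) * (F.Dr - F.Xr * Γ) := by
    linear_combination (norm := noncomm_ring) h3 + h4 * Γ - Γ * h1 - Γ * h2 * Γ
  refine
    { stable_Nr := isStableMatrix_iff.2 <| add_mem hF.stable_Nr.mem_stable
        (mul_mem hF.stable_Yr.mem_stable hΓ.mem_stable)
      stable_Dr := isStableMatrix_iff.2 <| sub_mem hF.stable_Dr.mem_stable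
        (mul_mem hF.stable_Xr.mem_stable hΓ.mem_stable)
      stable_Nl := isStableMatrix_iff.2 <| add_mem hF.stable_Nl.mem_stable
        (mul_mem hΓ.mem_stable hF.stable_Yl.mem_stable)
      stable_Dl := isStableMatrix_iff.2 <| sub_mem hF.stable_Dl.mem_stable
        (mul_mem hΓ.mem_stable hF.stable_Xl.mem_stable)
      stable_Xl := hF.stable_Xl
      stable_Yl := hF.stable_Yl
      stable_Xr := hF.stable_Xr
      stable_Yr := hF.stable_Yr
      det_Dr := hr
      det_Dl := hl
      eq_right := rfl
      eq_left := ?_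
      bezout := ?_ }
  · simp only [Fractions.dual]
    have hl' : IsUnit (F.Dl - Γ * F.Xl).det := hl.1.isUnit
    have hr' : IsUnit (F.Dr - F.Xr * Γ).det := hr.1.isUnit
    rw [← nonsing_inv_mul_cancel_left (F.Dl - Γ * F.Xl) ((F.Nr + F.Yr * Γ) * _) hl',
      ← mul_assoc, ← mul_assoc, mul_assoc _ _ (F.Nr + F.Yr * Γ), e3, ← mul_assoc,
      mul_nonsing_inv_cancel_right _ _ hr']
  · simp only [Fractions.dual]
    rw [fromBlocks_multiply, ← fromBlocks_one, fromBlocks_inj]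
    refine ⟨?_, ?_, ?_, ?_⟩
    · linear_combination (norm := noncomm_ring) h1 + h2 * Γ
    · linear_combination (norm := noncomm_ring) h2
    · linear_combination (norm := noncomm_ring) e3
    · linear_combination (norm := noncomm_ring) h4 - Γ * h2

theorem Fractions.IsDCF.noZeroAtInfinity_det_dual (hF : F.IsDCF T) {β : RatFunc ℝ}
    (hβ : β.intDegree < 0) (i j : ι) :
    NoZeroAtInfinity (F.Dr - F.Xr * single i j β).det ∧
      NoZeroAtInfinity (F.Dl - single i j β * F.Xl).det := by
  constructor
  · have h : F.Dr - F.Xr * single i j β = F.Dr * (1 - (F.Dr⁻¹ * F.Xr) * single i j β) := by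
      rw [mul_sub, mul_one, ← mul_assoc, mul_nonsing_inv_cancel_left _ _ hF.isUnit_det_Dr]
    rw [h, det_mul, det_one_sub_mul_comm, det_one_sub_single_mul]
    exact hF.det_Dr.mul (noZeroAtInfinity_one_sub_mul hβ (mem_matrixSubring.1
      (mul_mem (inv_mem_matrixSubring hF.stable_Dr.mem_proper hF.det_Dr.inv_mem)
        hF.stable_Xr.mem_proper) _ _))
  · have h : F.Dl - single i j β * F.Xl = (1 - single i j β * (F.Xl * F.Dl⁻¹)) * F.Dl := by
      rw [sub_mul, one_mul, mul_assoc, nonsing_inv_mul_cancel_right _ _ hF.isUnit_det_Dl]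
    rw [h, det_mul, det_one_sub_single_mul]
    exact (noZeroAtInfinity_one_sub_mul hβ (mem_matrixSubring.1
      (mul_mem hF.stable_Xl.mem_proper
        (inv_mem_matrixSubring hF.stable_Dl.mem_proper hF.det_Dl.inv_mem))
        _ _)).mul hF.det_Dl

theorem norm_eval_mul_single_le {A : RatMatrix ι} (hA : IsStableMatrix A) {β : RatFunc ℝ}
    (hβ : IsStableFun β) {C δ : ℝ}
    (hC : ∀ i j, ∀ z : ℂ, 0 ≤ z.re → ‖RatFunc.eval (algebraMap ℝ ℂ) z (A i j)‖ ≤ C)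
    (hδ : ∀ z : ℂ, 0 ≤ z.re → ‖RatFunc.eval (algebraMap ℝ ℂ) z β‖ ≤ δ) (i j k l : ι) {z : ℂ}
    (hz : 0 ≤ z.re) :
    ‖RatFunc.eval (algebraMap ℝ ℂ) z ((A * single i j β) k l)‖ ≤ C * δ ∧
      ‖RatFunc.eval (algebraMap ℝ ℂ) z ((single i j β * A) k l)‖ ≤ C * δ := by
  have hδ0 : 0 ≤ δ := (norm_nonneg _).trans (hδ z hz)
  have hC0 : 0 ≤ C := (norm_nonneg _).trans (hC i j z hz)
  constructor
  · by_cases h : l = j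
    · rw [h, mul_single_apply_same, eval_mul_of_mem ((hA k i).2 z hz) (hβ.2 z hz), norm_mul]
      exact mul_le_mul (hC k i z hz) (hδ z hz) (norm_nonneg _) hC0
    · rw [mul_single_apply_of_ne _ _ _ _ _ h, RatFunc.eval_zero, norm_zero]
      positivity
  · by_cases h : k = i
    · rw [h, single_mul_apply_same, mul_comm β, eval_mul_of_mem ((hA j l).2 z hz) (hβ.2 z hz),
        norm_mul]
      exact mul_le_mul (hC j l z hz) (hδ z hz) (norm_nonneg _) hC0
    · rw [single_mul_apply_of_ne _ _ _ _ _ h, RatFunc.eval_zero, norm_zero]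
      positivity

/-- A neighbourhood of `T` contains the perturbations of `T` in a single entry of `Γ` by small
functions vanishing at infinity. The last property keeps the denominators without zeros at
infinity. -/
theorem IsNeighbourhood.exists_dual_mem {U : Set (RatMatrix ι)} (hU : IsNeighbourhood T U) :
    ∃ F : Fractions ι, F.IsDCF T ∧ ∃ δ : ℝ, 0 < δ ∧ ∀ (β : RatFunc ℝ) (i j : ι),
      IsStableFun β → β.intDegree < 0 →
      (∀ z : ℂ, 0 ≤ z.re → ‖RatFunc.eval (algebraMap ℝ ℂ) z β‖ ≤ δ) →
      (F.dual (single i j β)).Nr * (F.dual (single i j β)).Dr⁻¹ ∈ U := by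
  obtain ⟨F, hF, ε, hε, hU⟩ := hU
  obtain ⟨C₁, hC₁⟩ := hF.stable_Xl.exists_bound
  obtain ⟨C₂, hC₂⟩ := hF.stable_Yl.exists_bound
  obtain ⟨C₃, hC₃⟩ := hF.stable_Xr.exists_bound
  obtain ⟨C₄, hC₄⟩ := hF.stable_Yr.exists_bound
  set C := |C₁| + |C₂| + |C₃| + |C₄| + 1 with hC
  have hCpos : 0 < C := by positivity
  have hle₁ : C₁ ≤ C := by
    linarith [le_abs_self C₁, abs_nonneg C₂, abs_nonneg C₃, abs_nonneg C₄]
  have hle₂ : C₂ ≤ C := by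
    linarith [le_abs_self C₂, abs_nonneg C₁, abs_nonneg C₃, abs_nonneg C₄]
  have hle₃ : C₃ ≤ C := by
    linarith [le_abs_self C₃, abs_nonneg C₁, abs_nonneg C₂, abs_nonneg C₄]
  have hle₄ : C₄ ≤ C := by
    linarith [le_abs_self C₄, abs_nonneg C₁, abs_nonneg C₂, abs_nonneg C₃]
  refine ⟨F, hF, ε / C, by positivity, fun β i j hβ hdeg hsmall => ?_⟩
  have hΓ : IsStableMatrix (single i j β) := by
    intro k l
    rw [single_apply]
    split_ifs
    · exact hβ
    · exact mem_stableSubring.1 stableSubring.zero_mem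
  obtain ⟨hr, hl⟩ := hF.noZeroAtInfinity_det_dual hdeg i j
  have hCε : C * (ε / C) = ε := mul_div_cancel₀ _ hCpos.ne'
  have hneg : ∀ (A : RatMatrix ι), IsStableMatrix A → ∀ k l, ∀ z : ℂ, 0 ≤ z.re →
      ‖RatFunc.eval (algebraMap ℝ ℂ) z ((-A) k l)‖ = ‖RatFunc.eval (algebraMap ℝ ℂ) z (A k l)‖ := by
    intro A hA k l z hz
    rw [← norm_neg]
    congr 1
    have h := map_neg (evalHom z) ⟨A k l, (hA k l).2 z hz⟩
    exact neg_eq_iff_eq_neg.2 h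
  refine hU _ _ (hF.dual hΓ hr hl) ?_ ?_ ?_ ?_ <;> intro k l z hz <;>
    rw [← Matrix.sub_apply] <;> simp only [Fractions.dual]
  · rw [add_sub_cancel_left, ← hCε]
    exact (norm_eval_mul_single_le hF.stable_Yr hβ (fun i j z hz => (hC₄ i j z hz).trans hle₄)
      hsmall i j k l hz).1
  · rw [sub_sub_cancel_left, hneg _ (isStableMatrix_iff.2 (mul_mem
      hF.stable_Xr.mem_stable hΓ.mem_stable)) k l z hz, ← hCε]
    exact (norm_eval_mul_single_le hF.stable_Xr hβ (fun i j z hz => (hC₃ i j z hz).trans hle₃)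
      hsmall i j k l hz).1
  · rw [add_sub_cancel_left, ← hCε]
    exact (norm_eval_mul_single_le hF.stable_Yl hβ (fun i j z hz => (hC₂ i j z hz).trans hle₂)
      hsmall i j k l hz).2
  · rw [sub_sub_cancel_left, hneg _ (isStableMatrix_iff.2 (mul_mem
      hΓ.mem_stable hF.stable_Xl.mem_stable)) k l z hz, ← hCε]
    exact (norm_eval_mul_single_le hF.stable_Xl hβ (fun i j z hz => (hC₁ i j z hz).trans hle₁)
      hsmall i j k l hz).2

/-- If `Γ` perturbs `T` to `T'`, the interconnection with the compensator of the parameter `Q`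
has `Z' = Nr' (1 - Q Γ)⁻¹ R`. This is the resulting formula for the change of `Z`, cleared of
denominators. -/
theorem Fractions.IsDCF.interconnection_dual (hF : F.IsDCF T) {Q Γ : RatMatrix ι}
    (hP : IsUnit (F.Xl - Q * F.Dl).det) (hR : IsUnit (F.Yl + Q * F.Nl).det)
    (hTc : F.Yl + Q * F.Nl = (F.Xl - Q * F.Dl) * Tc) (hD : IsUnit (F.Dr - F.Xr * Γ).det)
    (hT : IsUnit T.det) (hsum : IsUnit (T⁻¹ + Tc⁻¹).det)
    (hT' : IsUnit ((F.dual Γ).Nr * (F.dual Γ).Dr⁻¹).det)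
    (hsum' : IsUnit (((F.dual Γ).Nr * (F.dual Γ).Dr⁻¹)⁻¹ + Tc⁻¹).det) :
    (F.Yr + F.Nr * Q) * Γ = ((((F.dual Γ).Nr * (F.dual Γ).Dr⁻¹)⁻¹ + Tc⁻¹)⁻¹ - (T⁻¹ + Tc⁻¹)⁻¹) *
      (F.Yl + Q * F.Nl)⁻¹ * (1 - Q * Γ) := by
  have key : ∀ {N D T' : RatMatrix ι}, T' = N * D⁻¹ → IsUnit D.det → IsUnit T'.det →
      IsUnit (T'⁻¹ + Tc⁻¹).det → (T'⁻¹ + Tc⁻¹)⁻¹ * (F.Yl + Q * F.Nl)⁻¹ *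
        ((F.Xl - Q * F.Dl) * N + (F.Yl + Q * F.Nl) * D) = N := by
    intro N D T' h hD hT' hs
    have hN : IsUnit N.det := by
      rw [h, det_mul] at hT'
      exact isUnit_of_mul_isUnit_left hT'
    have h1 := nonsing_inv_mul _ hs
    nth_rw 2 [inv_add_inv_eq h hTc hN hD hR hP] at h1
    have h2 := congrArg (· * N) h1
    simp only [one_mul] at h2
    rwa [← mul_assoc, ← mul_assoc, nonsing_inv_mul_cancel_right _ _ hN] at h2
  have h0 := key hF.eq_right hF.isUnit_det_Dr hT hsum
  have h1 := key rfl hD hT' hsum'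
  rw [hF.param_bezout, mul_one] at h0
  have h2 : (F.Xl - Q * F.Dl) * (F.Nr + F.Yr * Γ) + (F.Yl + Q * F.Nl) * (F.Dr - F.Xr * Γ) =
      1 - Q * Γ := by
    linear_combination (norm := noncomm_ring) hF.param_bezout Q - hF.param_recover Q * Γ
  simp only [Fractions.dual] at h1 ⊢
  rw [h2] at h1
  rw [sub_mul, sub_mul, h1, h0]
  noncomm_ring

theorem exists_apply_ne_zero_of_isUnit_det {K : Type*} [Field K] {A : Matrix ι ι K}
    (hA : IsUnit A.det) (j : ι) : (∃ k, A k j ≠ 0) ∧ ∃ l, A j l ≠ 0 := by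
  constructor <;> by_contra! h
  · exact hA.ne_zero (det_eq_zero_of_column_eq_zero j h)
  · exact hA.ne_zero (det_eq_zero_of_row_eq_zero j h)

end

theorem HInfClose.refl {ι : Type*} {ε : ℝ} (hε : 0 ≤ ε) (A : RatMatrix ι) : HInfClose ε A A := by
  intro i j z _
  rw [sub_self, RatFunc.eval_zero, norm_zero]
  exact hε

section

variable {ι : Type*} [Fintype ι] [DecidableEq ι] {T Tc : RatMatrix ι} {F : Fractions ι}

/-! ### Necessity -/

/-- With respect to the factorization that defines the neighbourhood, the parameter of a
stabilizing compensator is stable. If the entry `(j, i)` of `Q` had a pole in the closed right half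
plane, a small perturbation `β` in the entry `(i, j)` of `Γ` could be chosen so that `1 - β Q j i`
vanishes nearby, and the hybrid matrix of the perturbed interconnection would have a pole there. -/
theorem IsStabilizing.exists_stable_param (hT : IsNetworkFunction T) (h : IsStabilizing T Tc) :
    ∃ F : Fractions ι, F.IsDCF T ∧ ∃ Q : RatMatrix ι, IsStableMatrix Q ∧
      F.Yl + Q * F.Nl = (F.Xl - Q * F.Dl) * Tc := by
  obtain ⟨hTc, hst, U, hU, hrob⟩ := h
  obtain ⟨F, hF, δ, hδ, hdual⟩ := hU.exists_dual_mem
  have hsum := isUnit_det_add hT.isUnit_det hTc.isUnit_det hst.isUnit_det_sum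
  obtain ⟨Q, hQ, hQR⟩ := hF.exists_param hsum
  have hP : IsUnit (F.Xl - Q * F.Dl).det := isUnit_det_of_right_inverse (hF.left_denom_mul hQR)
  have hR : IsUnit (F.Yl + Q * F.Nl).det := by
    rw [hQR, det_mul]
    exact hP.mul hTc.isUnit_det
  have hS : IsUnit (F.Yr + F.Nr * Q).det := by
    rw [hF.right_num_eq hQR, det_mul]
    exact hTc.isUnit_det.mul (isUnit_det_of_right_inverse (hF.right_denom_mul hQR))
  refine ⟨F, hF, Q, ?_, hQR⟩
  intro j i
  constructor
  · -- Properness holds without perturbation, since `T`, `Tc` and their inverses are proper.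
    have hW : (T + Tc)⁻¹ = Tc⁻¹ * (T⁻¹ + Tc⁻¹)⁻¹ * T⁻¹ := by
      rw [add_eq_mul_inv_add_inv_mul hT.isUnit_det hTc.isUnit_det, Matrix.mul_inv_rev,
        Matrix.mul_inv_rev, mul_assoc]
    have hmem : Q ∈ matrixSubring properSubring := by
      rw [hQ, hW]
      exact mul_mem (sub_mem hF.stable_Xl.mem_proper
        (mul_mem (inv_mem_matrixSubring hF.stable_Dr.mem_proper hF.det_Dr.inv_mem)
          (mul_mem (mul_mem (isProperMatrix_iff.1 hTc.proper_inv) hst.stable.mem_proper)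
            (isProperMatrix_iff.1 hT.proper_inv))))
        (inv_mem_matrixSubring hF.stable_Dl.mem_proper hF.det_Dl.inv_mem)
    exact mem_matrixSubring.1 hmem j i
  · intro z₀ hz₀
    by_contra hpole
    obtain ⟨⟨k, hk⟩, -⟩ := exists_apply_ne_zero_of_isUnit_det hS i
    obtain ⟨-, ⟨l, hl⟩⟩ := exists_apply_ne_zero_of_isUnit_det hR j
    set g := (F.Yr + F.Nr * Q) k i * (F.Yl + Q * F.Nl) j l with hg
    obtain ⟨a, b, z, hz, hhz, hgz, hgne, hone, hab⟩ :=
      exists_interpolant (h := Q j i) (g := g) hz₀ (fun h => h hpole) (mul_ne_zero hk hl) hδ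
    set β := interpolant a b with hβ
    have hβ0 : β ≠ 0 := by
      intro h0
      rw [h0, RatFunc.eval_zero, zero_mul] at hone
      exact zero_ne_one hone
    have hdeg : β.intDegree < 0 := intDegree_interpolant_neg hβ0
    have hβst : IsStableFun β := isStableFun_interpolant a b
    have hst' := hrob _ (hdual β i j hβst hdeg
      (fun z hz => (norm_eval_interpolant_le a b hz).trans hab))
    have hmain := hF.interconnection_dual hP hR hQR
      (hF.noZeroAtInfinity_det_dual hdeg i j).1.1.isUnit hT.isUnit_det hst.isUnit_det_sum
      hst'.isUnit_det hst'.isUnit_det_sum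
    have hE := sub_mem hst'.stable.mem_stable hst.stable.mem_stable
    have hentry := congrFun₂ (mul_single_mul_eq_smul hR hmain) k l
    generalize (((F.dual (single i j β)).Nr * (F.dual (single i j β)).Dr⁻¹)⁻¹ + Tc⁻¹)⁻¹ -
      (T⁻¹ + Tc⁻¹)⁻¹ = E at hE hentry
    have hleft : ((F.Yr + F.Nr * Q) * single i j β * (F.Yl + Q * F.Nl)) k l = β * g := by
      rw [Matrix.mul_apply, Finset.sum_eq_single j]
      · rw [mul_single_apply_same, hg]
        ring
      · intro m _ hm
        rw [mul_single_apply_of_ne _ _ _ _ _ hm, zero_mul]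
      · simp
    rw [hleft, Matrix.smul_apply, smul_eq_mul] at hentry
    have hβz : β ∈ regularSubring z := hβst.2 z hz
    have hEz : E k l ∈ regularSubring z :=
      stableSubring_le_regularSubring hz (mem_matrixSubring.1 hE k l)
    have hbh := mul_mem hβz hhz
    have h1 : RatFunc.eval (algebraMap ℝ ℂ) z (1 - β * Q j i) = 0 := by
      have h2 := map_sub (evalHom z) 1 ⟨β * Q j i, hbh⟩
      have h3 : evalHom z ⟨β * Q j i, hbh⟩ = 1 := (eval_mul_of_mem hβz hhz).trans hone
      rw [h3, map_one, sub_self] at h2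
      exact h2
    have hval := congrArg (RatFunc.eval (algebraMap ℝ ℂ) z) hentry
    rw [eval_mul_of_mem hβz hgz, eval_mul_of_mem (sub_mem (one_mem _) hbh) hEz, h1,
      zero_mul] at hval
    rcases mul_eq_zero.1 hval with h2 | h2
    · rw [h2, zero_mul] at hone
      exact zero_ne_one hone
    · exact hgne h2

/-- A stable parameter that yields a proper compensator is admissible. -/
theorem Fractions.IsDCF.isParameter_of_stable (hF : F.IsDCF T) (hT : IsProperMatrix T)
    (hTc : IsProperMatrix Tc) {Q : RatMatrix ι} (hQ : IsStableMatrix Q)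
    (h : F.Yl + Q * F.Nl = (F.Xl - Q * F.Dl) * Tc) : F.IsParameter Q := by
  have hsum : T + Tc ∈ matrixSubring properSubring :=
    add_mem (isProperMatrix_iff.1 hT) (isProperMatrix_iff.1 hTc)
  refine ⟨hQ, ?_, ?_⟩
  · refine noZeroAtInfinity_of_mul_eq_one (g := ((T + Tc) * F.Dr).det) ?_
      (det_mem_of_mem_matrixSubring (mul_mem hsum hF.stable_Dr.mem_proper))
    rw [← det_mul, hF.left_denom_mul h, det_one]
  · refine noZeroAtInfinity_of_mul_eq_one (g := (F.Dl * (T + Tc)).det) ?_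
      (det_mem_of_mem_matrixSubring (mul_mem hF.stable_Dl.mem_proper hsum))
    rw [← det_mul, hF.right_denom_mul h, det_one]

/-- The factorization that defines the neighbourhood need not be `F`, so the stable parameter is
carried over to `F` by `Fractions.IsDCF.change_fractions`. -/
theorem IsStabilizing.exists_isParameter (hT : IsNetworkFunction T) (hF : F.IsDCF T)
    (h : IsStabilizing T Tc) : ∃ Q : RatMatrix ι, F.IsParameter Q ∧
      Tc = (F.Xl - Q * F.Dl)⁻¹ * (F.Yl + Q * F.Nl) := by
  obtain ⟨F₀, hF₀, Q₀, hQ₀, hR₀⟩ := h.exists_stable_param hT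
  obtain ⟨-, hP, hR⟩ := hF.change_fractions hF₀ (hF₀.param_bezout Q₀)
  set Q := (F.Xl * F₀.Nr + F.Yl * F₀.Dr) *
    ((F₀.Yl + Q₀ * F₀.Nl) * F.Xr - (F₀.Xl - Q₀ * F₀.Dl) * F.Yr) with hQ
  have hQst : IsStableMatrix Q := isStableMatrix_iff.2 <|
    mul_mem (add_mem (mul_mem hF.stable_Xl.mem_stable hF₀.stable_Nr.mem_stable)
      (mul_mem hF.stable_Yl.mem_stable hF₀.stable_Dr.mem_stable))
    (sub_mem
      (mul_mem (add_mem hF₀.stable_Yl.mem_stable (mul_mem hQ₀.mem_stable hF₀.stable_Nl.mem_stable))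
        hF.stable_Xr.mem_stable)
      (mul_mem (sub_mem hF₀.stable_Xl.mem_stable (mul_mem hQ₀.mem_stable hF₀.stable_Dl.mem_stable))
        hF.stable_Yr.mem_stable))
  have hRP : F.Yl + Q * F.Nl = (F.Xl - Q * F.Dl) * Tc := by
    rw [hR, hP, hR₀, mul_assoc]
  have hpar := hF.isParameter_of_stable hT.proper h.networkFunction.proper hQst hRP
  exact ⟨Q, hpar, by rw [hRP, nonsing_inv_mul_cancel_left _ _ hpar.det_left.1.isUnit]⟩

/-! ### Sufficiency -/

theorem exists_pos_norm_det_sub_le (A : Matrix ι ι ℂ) {δ : ℝ} (hδ : 0 < δ) :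
    ∃ η : ℝ, 0 < η ∧ ∀ B : Matrix ι ι ℂ, (∀ i j, ‖B i j - A i j‖ ≤ η) →
      ‖B.det - A.det‖ ≤ δ := by
  -- The sup metric of `ι → ι → ℂ` is used, since matrices carry no global metric.
  let f : (ι → ι → ℂ) → ℂ := fun B => (Matrix.of B).det
  have hc : Continuous f :=
    Continuous.matrix_det (A := fun B : ι → ι → ℂ => Matrix.of B) continuous_id
  obtain ⟨η, hη, h⟩ := Metric.continuousAt_iff.1 (hc.continuousAt (x := fun i j => A i j)) δ hδ
  refine ⟨η / 2, by positivity, fun B hB => ?_⟩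
  have h1 : dist (fun i j => B i j) (fun i j => A i j) < η := by
    refine lt_of_le_of_lt ?_ (half_lt_self hη)
    rw [dist_pi_le_iff (by positivity)]
    intro i
    rw [dist_pi_le_iff (by positivity)]
    intro j
    rw [dist_eq_norm]
    exact hB i j
  have h2 := h h1
  rw [dist_eq_norm] at h2
  exact h2.le

theorem exists_eval_ne_zero {f : RatFunc ℝ} (hf : f ≠ 0) :
    ∃ z : ℂ, 0 ≤ z.re ∧ RatFunc.eval (algebraMap ℝ ℂ) z f ≠ 0 := by
  obtain ⟨t, h1, h2, ht⟩ := ((eventually_aeval_ne_zero (RatFunc.num_ne_zero hf) 0).and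
    ((eventually_aeval_ne_zero f.denom_ne_zero 0).and self_mem_nhdsWithin)).exists
  have ht : 0 < t := ht
  exact ⟨0 + t, by simpa using ht.le, div_ne_zero h1 h2⟩

/-- If the fractions of the perturbed matrix are close to those of `T`, then `P Nr' + R Dr'` is
close to `P Nr + R Dr = 1` and hence invertible over `𝕊`. -/
theorem exists_pos_stable_inv {N D P R : RatMatrix ι} (hN : IsStableMatrix N)
    (hD : IsStableMatrix D) (hP : IsStableMatrix P) (hR : IsStableMatrix R)
    (h : P * N + R * D = 1) :
    ∃ ε : ℝ, 0 < ε ∧ ∀ N' D' : RatMatrix ι, IsStableMatrix N' → IsStableMatrix D' →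
      HInfClose ε N' N → HInfClose ε D' D →
      IsUnit (P * N' + R * D').det ∧ IsStableMatrix (P * N' + R * D')⁻¹ := by
  obtain ⟨η, hη, hdet⟩ := exists_pos_norm_det_sub_le (1 : Matrix ι ι ℂ) (half_pos one_pos)
  obtain ⟨C₁, hC₁⟩ := hP.exists_bound
  obtain ⟨C₂, hC₂⟩ := hR.exists_bound
  set C := (Fintype.card ι + 1) * (|C₁| + |C₂| + 1) with hC
  have hCpos : 0 < C := by positivity
  refine ⟨η / C, by positivity, fun N' D' hN' hD' hNN' hDD' => ?_⟩
  have hU : P * N' + R * D' ∈ matrixSubring stableSubring :=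
    add_mem (mul_mem hP.mem_stable hN'.mem_stable)
      (mul_mem hR.mem_stable hD'.mem_stable)
  have hclose : ∀ z : ℂ, 0 ≤ z.re →
      1 / 2 ≤ ‖RatFunc.eval (algebraMap ℝ ℂ) z (P * N' + R * D').det‖ := by
    intro z hz
    have hUz := matrixSubring_mono (stableSubring_le_regularSubring hz) hU
    have hsplit : evalMatrix z (P * N' + R * D') - 1 =
        evalMatrix z P * evalMatrix z (N' - N) + evalMatrix z R * evalMatrix z (D' - D) := by
      rw [← evalMatrix_one, ← evalMatrix_sub hUz (one_mem _),
        ← evalMatrix_mul (hP.mem_regular hz) (sub_mem (hN'.mem_regular hz) (hN.mem_regular hz)),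
        ← evalMatrix_mul (hR.mem_regular hz) (sub_mem (hD'.mem_regular hz) (hD.mem_regular hz)),
        ← evalMatrix_add (mul_mem (hP.mem_regular hz)
          (sub_mem (hN'.mem_regular hz) (hN.mem_regular hz)))
          (mul_mem (hR.mem_regular hz) (sub_mem (hD'.mem_regular hz) (hD.mem_regular hz)))]
      congr 1
      linear_combination (norm := noncomm_ring) h
    have hbound : ∀ {A B : RatMatrix ι} {c : ℝ}, (∀ i j, ∀ z : ℂ, 0 ≤ z.re →
        ‖RatFunc.eval (algebraMap ℝ ℂ) z (A i j)‖ ≤ c) →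
        (∀ i j, ‖RatFunc.eval (algebraMap ℝ ℂ) z (B i j)‖ ≤ η / C) → ∀ i j,
        ‖(evalMatrix z A * evalMatrix z B) i j‖ ≤ Fintype.card ι * (|c| * (η / C)) := by
      intro A B c hA hB i j
      rw [Matrix.mul_apply, ← nsmul_eq_mul, ← Finset.card_univ]
      refine (norm_sum_le _ _).trans (Finset.sum_le_card_nsmul _ _ _ fun k _ => ?_)
      rw [norm_mul]
      exact mul_le_mul ((hA i k z hz).trans (le_abs_self c)) (hB k j) (norm_nonneg _)
        (abs_nonneg c)
    have hle : ‖(evalMatrix z (P * N' + R * D')).det - (1 : Matrix ι ι ℂ).det‖ ≤ 1 / 2 := by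
      refine hdet _ fun i j => ?_
      rw [← Matrix.sub_apply, hsplit, Matrix.add_apply]
      refine (norm_add_le _ _).trans ((add_le_add
        (hbound hC₁ (fun i j => hNN' i j z hz) i j)
        (hbound hC₂ (fun i j => hDD' i j z hz) i j)).trans ?_)
      have h1 : Fintype.card ι * (|C₁| * (η / C)) + Fintype.card ι * (|C₂| * (η / C)) =
          Fintype.card ι * (|C₁| + |C₂|) * η / C := by ring
      rw [h1, div_le_iff₀ hCpos, mul_comm η]
      refine mul_le_mul_of_nonneg_right ?_ hη.le
      rw [hC]
      exact mul_le_mul (by linarith) (by linarith) (by positivity) (by positivity)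
    rw [det_one, det_evalMatrix hUz] at hle
    have h1 := norm_sub_norm_le (1 : ℂ) (RatFunc.eval (algebraMap ℝ ℂ) z (P * N' + R * D').det)
    rw [norm_one, norm_sub_rev] at h1
    linarith
  have hdetst := mem_stableSubring.1 (det_mem_of_mem_matrixSubring hU)
  constructor
  · refine IsUnit.mk0 _ fun h0 => ?_
    have := hclose 0 le_rfl
    rw [h0, RatFunc.eval_zero, norm_zero] at this
    norm_num at this
  · exact isStableMatrix_iff.2
      (inv_mem_matrixSubring hU (mem_stableSubring.2 (hdetst.inv (half_pos one_pos) hclose)))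

/-- Closeness at a single point where `det N` does not vanish already preserves invertibility. -/
theorem exists_pos_isUnit_det {N : RatMatrix ι} (hN : IsStableMatrix N) (hu : IsUnit N.det) :
    ∃ ε : ℝ, 0 < ε ∧ ∀ N' : RatMatrix ι, IsStableMatrix N' → HInfClose ε N' N →
      IsUnit N'.det := by
  obtain ⟨z, hz, hne⟩ := exists_eval_ne_zero hu.ne_zero
  rw [← det_evalMatrix (hN.mem_regular hz)] at hne
  obtain ⟨η, hη, hdet⟩ :=
    exists_pos_norm_det_sub_le (evalMatrix z N) (half_pos (norm_pos_iff.2 hne))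
  refine ⟨η, hη, fun N' hN' hclose => IsUnit.mk0 _ fun h0 => ?_⟩
  have h1 := hdet (evalMatrix z N') fun i j => by
    rw [← Matrix.sub_apply, ← evalMatrix_sub (hN'.mem_regular hz) (hN.mem_regular hz)]
    exact hclose i j z hz
  rw [det_evalMatrix (hN'.mem_regular hz), h0, RatFunc.eval_zero, zero_sub, norm_neg] at h1
  linarith [norm_pos_iff.2 hne]

/-- With `P = Xl - Q Dl` and `R = Yl + Q Nl`, the hybrid matrix of the interconnection with `T'` is
`Nr' (P Nr' + R Dr')⁻¹ R`, and the matrix in the middle is stable for all `T'` close to `T`. -/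
theorem Fractions.IsDCF.isStabilizing (hT : IsNetworkFunction T) (hF : F.IsDCF T)
    (hTc : IsNetworkFunction Tc) {Q : RatMatrix ι} (hQ : F.IsParameter Q)
    (h : Tc = (F.Xl - Q * F.Dl)⁻¹ * (F.Yl + Q * F.Nl)) : IsStabilizing T Tc := by
  have hP : IsUnit (F.Xl - Q * F.Dl).det := hQ.det_left.1.isUnit
  have hRP : F.Yl + Q * F.Nl = (F.Xl - Q * F.Dl) * Tc := by
    rw [h, mul_nonsing_inv_cancel_left _ _ hP]
  have hR : IsUnit (F.Yl + Q * F.Nl).det := by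
    rw [hRP, det_mul]
    exact hP.mul hTc.isUnit_det
  have hPst : IsStableMatrix (F.Xl - Q * F.Dl) := isStableMatrix_iff.2 <|
    sub_mem hF.stable_Xl.mem_stable (mul_mem hQ.stable.mem_stable hF.stable_Dl.mem_stable)
  have hRst : IsStableMatrix (F.Yl + Q * F.Nl) := isStableMatrix_iff.2 <|
    add_mem hF.stable_Yl.mem_stable (mul_mem hQ.stable.mem_stable hF.stable_Nl.mem_stable)
  have hN : IsUnit F.Nr.det := by
    rw [← hF.T_mul_Dr, det_mul]
    exact hT.isUnit_det.mul hF.isUnit_det_Dr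
  obtain ⟨ε₁, hε₁, h₁⟩ :=
    exists_pos_stable_inv hF.stable_Nr hF.stable_Dr hPst hRst (hF.param_bezout Q)
  obtain ⟨ε₂, hε₂, h₂⟩ := exists_pos_isUnit_det hF.stable_Nr hN
  have key : ∀ (T' : RatMatrix ι) (F' : Fractions ι), F'.IsDCF T' →
      HInfClose (min ε₁ ε₂) F'.Nr F.Nr → HInfClose (min ε₁ ε₂) F'.Dr F.Dr →
      InterconnectionStable T' Tc := by
    intro T' F' hF' hNN hDD
    obtain ⟨hU, hUst⟩ := h₁ F'.Nr F'.Dr hF'.stable_Nr hF'.stable_Dr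
      (fun i j z hz => (hNN i j z hz).trans (min_le_left _ _))
      (fun i j z hz => (hDD i j z hz).trans (min_le_left _ _))
    have hN' := h₂ F'.Nr hF'.stable_Nr (fun i j z hz => (hNN i j z hz).trans (min_le_right _ _))
    have heq := inv_add_inv_eq hF'.eq_right hRP hN' hF'.isUnit_det_Dr hR hP
    refine ⟨?_, hTc.isUnit_det, ?_, ?_⟩
    · rw [hF'.eq_right, det_mul]
      exact hN'.mul (isUnit_nonsing_inv_det_iff.2 hF'.isUnit_det_Dr)
    · rw [heq, det_mul, det_mul]
      exact ((isUnit_nonsing_inv_det_iff.2 hR).mul hU).mul (isUnit_nonsing_inv_det_iff.2 hN')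
    · rw [heq, Matrix.mul_inv_rev, Matrix.mul_inv_rev, nonsing_inv_nonsing_inv _ hN',
        nonsing_inv_nonsing_inv _ hR]
      exact isStableMatrix_iff.2 (mul_mem hF'.stable_Nr.mem_stable
        (mul_mem hUst.mem_stable hRst.mem_stable))
  have hε : 0 < min ε₁ ε₂ := lt_min hε₁ hε₂
  refine ⟨hTc, key T F hF (HInfClose.refl hε.le _) (HInfClose.refl hε.le _),
    {T' | InterconnectionStable T' Tc}, ⟨F, hF, _, hε, ?_⟩, fun T' hT' => hT'⟩
  intro T' F' hF' hNN hDD _ _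
  exact key T' F' hF' hNN hDD

theorem Fractions.IsDCF.left_form_eq_right_form (hF : F.IsDCF T) {Q : RatMatrix ι}
    (hQ : F.IsParameter Q) :
    (F.Xl - Q * F.Dl)⁻¹ * (F.Yl + Q * F.Nl) = (F.Yr + F.Nr * Q) * (F.Xr - F.Dr * Q)⁻¹ := by
  have hP : IsUnit (F.Xl - Q * F.Dl).det := hQ.det_left.1.isUnit
  have hP' : IsUnit (F.Xr - F.Dr * Q).det := hQ.det_right.1.isUnit
  rw [← nonsing_inv_mul_cancel_left _ ((F.Yr + F.Nr * Q) * _) hP, ← mul_assoc _ (F.Yr + _),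
    hF.param_comm, mul_nonsing_inv_cancel_right _ _ hP']

end

theorem mainTheorem2 {ι : Type*} [Fintype ι] [DecidableEq ι]
    (T : RatMatrix ι) (hT : IsNetworkFunction T)
    (F : Fractions ι) (hF : F.IsDCF T) :
    (∀ Q : RatMatrix ι, F.IsParameter Q →
      (F.Xl - Q * F.Dl)⁻¹ * (F.Yl + Q * F.Nl) = (F.Yr + F.Nr * Q) * (F.Xr - F.Dr * Q)⁻¹) ∧
    {Tc : RatMatrix ι | IsStabilizing T Tc} =
      {Tc : RatMatrix ι | IsNetworkFunction Tc ∧ ∃ Q : RatMatrix ι, F.IsParameter Q ∧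
        Tc = (F.Xl - Q * F.Dl)⁻¹ * (F.Yl + Q * F.Nl)} ∧
    {Tc : RatMatrix ι | IsStabilizing T Tc} =
      {Tc : RatMatrix ι | IsNetworkFunction Tc ∧ ∃ Q : RatMatrix ι, F.IsParameter Q ∧
        Tc = (F.Yr + F.Nr * Q) * (F.Xr - F.Dr * Q)⁻¹} := by
  refine ⟨fun Q hQ => hF.left_form_eq_right_form hQ, ?_, ?_⟩
  · ext Tc
    constructor
    · exact fun h => ⟨h.networkFunction, h.exists_isParameter hT hF⟩
    · rintro ⟨hTc, Q, hQ, h⟩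
      exact hF.isStabilizing hT hTc hQ h
  · ext Tc
    constructor
    · intro h
      obtain ⟨Q, hQ, hTc⟩ := h.exists_isParameter hT hF
      exact ⟨h.networkFunction, Q, hQ, hTc.trans (hF.left_form_eq_right_form hQ)⟩
    · rintro ⟨hTc, Q, hQ, h⟩
      exact hF.isStabilizing hT hTc hQ (h.trans (hF.left_form_eq_right_form hQ).symm)
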